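/- **Setting.** Formulas are built from countably many variables with the connectives $\wedge,\vee,{\sim},\nabla,\bot,\top$. A *logic* is a substitution-invariant consequence relation $\vdash$ between sets of formulas and formulas (reflexive, monotone, closed under cut). For a logic $L$ and a set $R$ of rules, $L+R$ is the least logic containing $L$ and $R$ (an axiom is a rule without premisses). For an algebra $\mathbf A$ and $D\subseteq A$, $\Gamma\vdash\varphi$ holds in $\mathrm{Log}\langle\mathbf A,D\rangle$ iff every homomorphism $v$ from the formula algebra to $\mathbf A$ with $v[\Gamma]\subseteq D$ satisfies $v(\varphi)\in D$; the logic of a class of such matrices is the intersection of their logics. An *involutive Stone algebra* is a De Morgan algebra $\langle A;\wedge,\vee,{\sim},\bot,\top\rangle$ (a bounded distributive lattice with ${\sim}(x\vee y)={\sim}x\wedge{\sim}y$, ${\sim}(x\wedge y)={\sim}x\vee{\sim}y$, ${\sim}{\sim}x=x$, ${\sim}\top=\bot$, ${\sim}\bot=\top$) with a unary operation $\nabla$ such that $\nabla\bot=\bot$, $x=x\wedge\nabla x$, $\nabla(x\wedge y)=\nabla x\wedge\nabla y$ and ${\sim}\nabla x\wedge\nabla x=\bot$. Let $\mathsf{IS}$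 be the class of these algebras, and $\vdash^1_{\mathsf{IS}}$ its *1-assertional logic*, the logic of the class of matrices $\{\langle\mathbf A,\{\top\}\rangle:\mathbf A\in\mathsf{IS}\}$. The *order-preserving logic* $\vdash^{\le}_{\mathsf K}$ of a class $\mathsf K$ of such algebras is given by: $\emptyset\vdash\varphi$ iff $\varphi\approx\top$ is valid in $\mathsf K$; and, for $\Gamma\ne\emptyset$, $\Gamma\vdash\varphi$ iff there are $n\ge1$ and $\gamma_1,\dots,\gamma_n\in\Gamma$ such that $\gamma_1\wedge\dots\wedge\gamma_n\wedge\varphi\approx\gamma_1\wedge\dots\wedge\gamma_n$ is valid in $\mathsf K$. Put $\mathcal{IS}_{\le}:={\vdash^{\le}_{\mathsf{IS}}}$. $\mathbb V(\mathbf A)$ denotes the variety generated by $\mathbf A$. Let $\mathbf{DM}_4$ be the De Morgan algebra on $\{0,a,b,1\}$ with $0<a,b<1$, $a,b$ incomparable, ${\sim}0=1$, ${\sim}1=0$, ${\sim}a=a$, ${\sim}b=b$; let $\mathbf K_3$ and $\mathbf B_2$ be its subalgebras on $\{0,a,1\}$ and $\{0,1\}$, and let $\mathbf T$ be the one-element De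 Morgan algebra, whose only element is called $0$. The algebras $\mathbf{IS}_6,\mathbf{IS}_5,\mathbf{IS}_4,\mathbf{IS}_3$ are obtained from $\mathbf{DM}_4,\mathbf K_3,\mathbf B_2,\mathbf T$, respectively, by adjoining a new least element $\bot$ and a new greatest element $\top$ (which interpret the constants), with ${\sim}\bot=\top$, ${\sim}\top=\bot$, $\nabla\bot=\bot$, and $\nabla x=\top$ for $x\ne\bot$. In each of them, ${\uparrow}0=\{x:0\le x\}$ where $0$ is the least element of the original De Morgan algebra. **Theorem.** (i) $\mathrm{Log}\langle\mathbf{IS}_6,\{\top\}\rangle=\mathrm{Log}\langle\mathbf{IS}_5,\{\top\}\rangle=\mathrm{Log}\langle\mathbf{IS}_4,\{\top\}\rangle=\mathrm{Log}\langle\mathbf{IS}_3,\{\top\}\rangle={\vdash^1_{\mathsf{IS}}}=\mathcal{IS}_{\le}+(p\vdash{\sim}\nabla{\sim}p)$. (ii) $\mathrm{Log}\{\langle\mathbf{IS}_3,\{\top\}\rangle,\langle\mathbf{IS}_3,{\uparrow}0\rangle\}={\vdash^{\le}_{\mathbb V(\mathbf{IS}_3)}}$, and this logic equals $\mathcal{IS}_{\le}$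 plus the three rules $$(p\wedge{\sim}p)\vee r\vdash q\vee{\sim}q\vee r,\qquad {\sim}p\vee r,\ \nabla p\vee r\vdash p\vee r,\qquad {\sim}\nabla p\vee r\vdash{\sim}p\vee r.$$ (iii) $\mathrm{Log}\langle\mathbf{IS}_6,{\uparrow}0\rangle=\mathrm{Log}\langle\mathbf{IS}_5,{\uparrow}0\rangle=\mathrm{Log}\langle\mathbf{IS}_4,{\uparrow}0\rangle=\mathrm{Log}\langle\mathbf{IS}_3,{\uparrow}0\rangle=\mathcal{IS}_{\le}+(\emptyset\vdash p\vee{\sim}\nabla p)$. -/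

import Mathlib

universe u v

namespace ISLogics

/-! ## Algebras -/

/-- An algebra in the language `∧, ∨, ~, ⊥, ⊤` of De Morgan algebras (no identities required). -/
structure DMStr : Type (u + 1) where
  carrier : Type u
  meet : carrier → carrier → carrier
  join : carrier → carrier → carrier
  neg : carrier → carrier
  bot : carrier
  top : carrier

/-- An algebra in the language `∧, ∨, ~, ∇, ⊥, ⊤` (no identities required). -/
structure ISStr : Type (u + 1) extends DMStr.{u} where
  nabla : carrier → carrier

/-- De Morgan algebras: bounded distributive lattices with a De Morgan involution. -/
structure IsDeMorganAlgebra (A : DMStr.{u}) : Prop where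
  meet_comm : ∀ x y, A.meet x y = A.meet y x
  meet_assoc : ∀ x y z, A.meet (A.meet x y) z = A.meet x (A.meet y z)
  join_comm : ∀ x y, A.join x y = A.join y x
  join_assoc : ∀ x y z, A.join (A.join x y) z = A.join x (A.join y z)
  meet_join_absorb : ∀ x y, A.meet x (A.join x y) = x
  join_meet_absorb : ∀ x y, A.join x (A.meet x y) = x
  distrib : ∀ x y z, A.meet x (A.join y z) = A.join (A.meet x y) (A.meet x z)
  bot_meet : ∀ x, A.meet A.bot x = A.bot
  top_join : ∀ x, A.join A.top x = A.top
  neg_join : ∀ x y, A.neg (A.join x y) = A.meet (A.neg x) (A.neg y)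
  neg_meet : ∀ x y, A.neg (A.meet x y) = A.join (A.neg x) (A.neg y)
  neg_neg : ∀ x, A.neg (A.neg x) = x
  neg_top : A.neg A.top = A.bot
  neg_bot : A.neg A.bot = A.top

/-- Involutive Stone algebras. -/
structure IsISAlgebra (A : ISStr.{u}) : Prop extends IsDeMorganAlgebra A.toDMStr where
  nabla_bot : A.nabla A.bot = A.bot
  meet_nabla : ∀ x, x = A.meet x (A.nabla x)
  nabla_meet : ∀ x y, A.nabla (A.meet x y) = A.meet (A.nabla x) (A.nabla y)
  neg_nabla_meet : ∀ x, A.meet (A.neg (A.nabla x)) (A.nabla x) = A.bot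

/-- The class `IS` of all involutive Stone algebras. -/
def ISClass : Set ISStr.{u} := {A | IsISAlgebra A}

/-! ## The variety generated by a class of algebras -/

structure IsHom (A : ISStr.{u}) (B : ISStr.{v}) (f : A.carrier → B.carrier) : Prop where
  map_meet : ∀ x y, f (A.meet x y) = B.meet (f x) (f y)
  map_join : ∀ x y, f (A.join x y) = B.join (f x) (f y)
  map_neg : ∀ x, f (A.neg x) = B.neg (f x)
  map_nabla : ∀ x, f (A.nabla x) = B.nabla (f x)
  map_bot : f A.bot = B.bot
  map_top : f A.top = B.top

/-- Direct products, computed coordinatewise. -/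
def ISStr.prod {I : Type u} (A : I → ISStr.{u}) : ISStr.{u} where
  carrier := ∀ i, (A i).carrier
  meet := fun x y i => (A i).meet (x i) (y i)
  join := fun x y i => (A i).join (x i) (y i)
  neg := fun x i => (A i).neg (x i)
  bot := fun i => (A i).bot
  top := fun i => (A i).top
  nabla := fun x i => (A i).nabla (x i)

/-- The variety `𝕍(K)`: the least class of algebras that contains `K` and is closed under
homomorphic images, (isomorphic copies of) subalgebras and direct products. -/
inductive Variety (K : Set ISStr.{u}) : ISStr.{u} → Prop
  | base (A : ISStr.{u}) : A ∈ K → Variety K A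
  | image (A B : ISStr.{u}) (f : A.carrier → B.carrier) :
      IsHom A B f → Function.Surjective f → Variety K A → Variety K B
  | sub (A B : ISStr.{u}) (f : A.carrier → B.carrier) :
      IsHom A B f → Function.Injective f → Variety K B → Variety K A
  | prod (I : Type u) (A : I → ISStr.{u}) :
      (∀ i, Variety K (A i)) → Variety K (ISStr.prod A)

def varietyOf (K : Set ISStr.{u}) : Set ISStr.{u} := {A | Variety K A}

/-- The class of all isomorphic copies of `A` in a given universe. -/
def isoCopies (A : ISStr.{v}) : Set ISStr.{u} :=
  {B | ∃ f : A.carrier → B.carrier, IsHom A B f ∧ Function.Bijective f}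

/-! ## The algebras `IS₃, IS₄, IS₅, IS₆` -/

/-- A set with a new bottom `bbot` and a new top `ttop` adjoined. -/
inductive Adj (α : Type u) : Type u
  | bbot : Adj α
  | elem : α → Adj α
  | ttop : Adj α

/-- The algebra `A^∇`, obtained from `A` by adjoining a new bottom and a new top. The old bounds
of `A` remain as elements but no longer interpret the constants. -/
def DMStr.withNabla (A : DMStr.{u}) : ISStr.{u} where
  carrier := Adj A.carrier
  meet
    | .bbot, _ => .bbot
    | .elem _, .bbot => .bbot
    | .elem x, .elem y => .elem (A.meet x y)
    | .elem x, .ttop => .elem x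
    | .ttop, y => y
  join
    | .ttop, _ => .ttop
    | .elem _, .ttop => .ttop
    | .elem x, .elem y => .elem (A.join x y)
    | .elem x, .bbot => .elem x
    | .bbot, y => y
  neg
    | .bbot => .ttop
    | .elem x => .elem (A.neg x)
    | .ttop => .bbot
  bot := .bbot
  top := .ttop
  nabla
    | .bbot => .bbot
    | .elem _ => .ttop
    | .ttop => .ttop

inductive Four : Type
  | zero | a | b | one

/-- The four-element De Morgan algebra: `0 < a, b < 1` with `a, b` incomparable, both fixed by the
negation. -/
def DM4 : DMStr.{0} where
  carrier := Four
  meet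
    | .zero, _ => .zero
    | .one, y => y
    | .a, .zero => .zero
    | .a, .a => .a
    | .a, .b => .zero
    | .a, .one => .a
    | .b, .zero => .zero
    | .b, .a => .zero
    | .b, .b => .b
    | .b, .one => .b
  join
    | .zero, y => y
    | .one, _ => .one
    | .a, .zero => .a
    | .a, .a => .a
    | .a, .b => .one
    | .a, .one => .one
    | .b, .zero => .b
    | .b, .a => .one
    | .b, .b => .b
    | .b, .one => .one
  neg
    | .zero => .one
    | .a => .a
    | .b => .b
    | .one => .zero
  bot := .zero
  top := .one

inductive Three : Type
  | zero | a | one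

/-- The three-element Kleene algebra: the chain `0 < a < 1` with `~a = a`. -/
def K3 : DMStr.{0} where
  carrier := Three
  meet
    | .zero, _ => .zero
    | .one, y => y
    | .a, .zero => .zero
    | .a, .a => .a
    | .a, .one => .a
  join
    | .zero, y => y
    | .one, _ => .one
    | .a, .zero => .a
    | .a, .a => .a
    | .a, .one => .one
  neg
    | .zero => .one
    | .a => .a
    | .one => .zero
  bot := .zero
  top := .one

/-- The two-element Boolean algebra. -/
def B2 : DMStr.{0} where
  carrier := Bool
  meet := and
  join := or
  neg := not
  bot := false
  top := true

/-- The one-element De Morgan algebra. -/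
def T1 : DMStr.{0} where
  carrier := Unit
  meet := fun _ _ => ()
  join := fun _ _ => ()
  neg := fun _ => ()
  bot := ()
  top := ()

def IS6 : ISStr.{0} := DM4.withNabla
def IS5 : ISStr.{0} := K3.withNabla
def IS4 : ISStr.{0} := B2.withNabla
def IS3 : ISStr.{0} := T1.withNabla

/-- The principal up-set `↑x = {y | x ≤ y}`, for the lattice order `x ≤ y ↔ x ∧ y = x`. -/
def ISStr.up (A : ISStr.{u}) (x : A.carrier) : Set A.carrier := {y | A.meet x y = x}

/-- The element `0` of `A^∇`, that is, the bottom element of `A` (not the new bottom). -/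
def DMStr.zeroIn (A : DMStr.{u}) : A.withNabla.carrier := Adj.elem A.bot

/-! ## Formulas and logics -/

/-- Formulas over the countably many variables `var 0, var 1, …`. -/
inductive Fm : Type
  | var : ℕ → Fm
  | meet : Fm → Fm → Fm
  | join : Fm → Fm → Fm
  | neg : Fm → Fm
  | nabla : Fm → Fm
  | bot : Fm
  | top : Fm

/-- The value of a formula; the maps `fun φ => φ.eval A h` are exactly the homomorphisms from the
formula algebra to `A`. -/
def Fm.eval (A : ISStr.{u}) (h : ℕ → A.carrier) : Fm → A.carrier
  | .var n => h n
  | .meet φ ψ => A.meet (φ.eval A h) (ψ.eval A h)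
  | .join φ ψ => A.join (φ.eval A h) (ψ.eval A h)
  | .neg φ => A.neg (φ.eval A h)
  | .nabla φ => A.nabla (φ.eval A h)
  | .bot => A.bot
  | .top => A.top

def Fm.subst (σ : ℕ → Fm) : Fm → Fm
  | .var n => σ n
  | .meet φ ψ => .meet (φ.subst σ) (ψ.subst σ)
  | .join φ ψ => .join (φ.subst σ) (ψ.subst σ)
  | .neg φ => .neg (φ.subst σ)
  | .nabla φ => .nabla (φ.subst σ)
  | .bot => .bot
  | .top => .top

/-- A relation between sets of formulas and formulas. -/
abbrev Consequence : Type := Set Fm → Fm → Prop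

/-- A logic is a structural (substitution-invariant) consequence relation. -/
structure IsLogic (L : Consequence) : Prop where
  identity : ∀ Γ φ, φ ∈ Γ → L Γ φ
  monotone : ∀ Γ Δ φ, Γ ⊆ Δ → L Γ φ → L Δ φ
  cut : ∀ Γ Δ φ, (∀ ψ ∈ Δ, L Γ ψ) → L Δ φ → L Γ φ
  structural : ∀ (σ : ℕ → Fm) Γ φ, L Γ φ → L (Fm.subst σ '' Γ) (φ.subst σ)

/-- `L + R`: the least logic that contains `L` and the rules in `R`. A rule is a pair of a set of
premisses and a conclusion; an axiom is a rule without premisses. -/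
def addRules (L : Consequence) (R : Set (Set Fm × Fm)) : Consequence := fun Γ φ =>
  ∀ L' : Consequence, IsLogic L' → (∀ Δ ψ, L Δ ψ → L' Δ ψ) → (∀ r ∈ R, L' r.1 r.2) → L' Γ φ

/-- A logical matrix. -/
structure LMatrix : Type (u + 1) where
  alg : ISStr.{u}
  designated : Set alg.carrier

/-- The logic of a class of matrices. -/
def Log (M : Set LMatrix.{u}) : Consequence := fun Γ φ =>
  ∀ m ∈ M, ∀ h : ℕ → m.alg.carrier,
    (∀ γ ∈ Γ, γ.eval m.alg h ∈ m.designated) → φ.eval m.alg h ∈ m.designated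

/-- The 1-assertional logic of a class of algebras. -/
def oneAssertional (K : Set ISStr.{u}) : Consequence :=
  Log ((fun A : ISStr.{u} => (⟨A, {A.top}⟩ : LMatrix.{u})) '' K)

/-- Validity of the identity `s ≈ t` in every algebra of the class `K`. -/
def ValidIdentity (K : Set ISStr.{u}) (s t : Fm) : Prop :=
  ∀ A ∈ K, ∀ h : ℕ → A.carrier, s.eval A h = t.eval A h

/-- The order-preserving logic of a class of algebras with a semilattice reduct with top `⊤`.
The conjunction `γ₁ ∧ … ∧ γₙ` (with `n ≥ 1`) of the list `γ :: l` is bracketed to the left. -/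
def orderPreserving (K : Set ISStr.{u}) : Consequence := fun Γ φ =>
  (Γ = ∅ ∧ ValidIdentity K φ Fm.top) ∨
  (Γ ≠ ∅ ∧ ∃ (γ : Fm) (l : List Fm), γ ∈ Γ ∧ (∀ δ ∈ l, δ ∈ Γ) ∧
    ValidIdentity K (Fm.meet (l.foldl Fm.meet γ) φ) (l.foldl Fm.meet γ))

/-- The logic `IS_≤`, i.e. the order-preserving logic of the class of involutive Stone algebras. -/
def ISle : Consequence := orderPreserving ISClass.{u}

/-! ## The rules -/

def p : Fm := Fm.var 0
def q : Fm := Fm.var 1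
def r : Fm := Fm.var 2

/-- `p ⊢ ~∇~p` -/
def ruleOne : Set Fm × Fm := ({p}, p.neg.nabla.neg)

/-- `(p ∧ ~p) ∨ r ⊢ (q ∨ ~q) ∨ r` -/
def ruleKleene : Set Fm × Fm := ({(p.meet p.neg).join r}, (q.join q.neg).join r)

/-- `~p ∨ r, ∇p ∨ r ⊢ p ∨ r` -/
def ruleA : Set Fm × Fm := ({p.neg.join r, p.nabla.join r}, p.join r)

/-- `~∇p ∨ r ⊢ ~p ∨ r` -/
def ruleB : Set Fm × Fm := ({p.nabla.neg.join r}, p.neg.join r)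

/-- `⊢ p ∨ ~∇p` -/
def axiomNabla : Set Fm × Fm := (∅, p.join p.nabla.neg)

end ISLogics

/-!
Everything reduces to the three-element algebra `IS₃`. For every De Morgan algebra `A` the map
`A^∇ → IS₃` that identifies all elements of `A` is a strict surjective homomorphism of matrices,
both for `{⊤}` and for `↑0` (`Log_withNabla_top`, `Log_withNabla_up`). So the logics of the
matrices on `IS₆`, `IS₅`, `IS₄` are those of `IS₃`.

Completeness of the three calculi rests on one construction. Write `Δφ = ~∇~φ`. A set of formulas
closed under an extension of `IS_≤` is a filter of the free involutive Stone algebra, and every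
filter omitting `φ` extends to a prime one, `F`, that omits `φ`
(`IsTheory.exists_isPrimeTheory`). As `∇` and `Δ` are lattice endomorphisms with complemented
values, sending `ψ` to `⊤` if `Δψ ∈ F`, to `0` if only `∇ψ ∈ F`, and to `⊥` otherwise is a
homomorphism into `IS₃` (`IsPrimeTheory.eval_valuation`).

* With `p ⊢ ~∇~p`, the premisses `γ` satisfy `Δγ ∈ F`, so they take the value `⊤`, whereas `φ`
  does not because `Δφ ≤ φ`.
* With `p ∨ ~∇p`, omitting `φ` means omitting `∇φ`, so `φ` takes the value `⊥`, whereas the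
  premisses do not because `γ ≤ ∇γ`.
* The rules with a side formula `r` let `F` be chosen closed under `α ∧ ~α ⊢ β ∨ ~β` and
  `~α, ∇α ⊢ α`. Then `F` is the preimage of `{⊤}` or of `↑0` (`IsPrimeTheory.delta_or_nabla`).

The order-preserving logic of `𝕍(IS₃)` is finitary by definition, whereas the finitarity of the
logic of the two matrices on `IS₃` needs an argument. It follows from a circle of inclusions: that
logic is below the calculus by completeness; the calculus has finitary rules, so it is below the
finitary companion of the logic of the matrices; this companion is below the order-preserving logic
because `{⊤}` and `↑0` determine the order of the chain `IS₃`; and the order-preserving logic is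
below the logic of the matrices by soundness.
-/

namespace ISLogics

/-! ### The order of an involutive Stone algebra -/

section Algebra

variable {A : ISStr.{u}}

/-- The distributive lattice underlying a De Morgan algebra. -/
abbrev IsDeMorganAlgebra.distribLattice {A : DMStr.{u}} (hA : IsDeMorganAlgebra A) :
    DistribLattice A.carrier :=
  letI : Max A.carrier := ⟨A.join⟩
  letI : Min A.carrier := ⟨A.meet⟩
  letI : Lattice A.carrier := Lattice.mk' hA.join_comm hA.join_assoc hA.meet_comm hA.meet_assoc
    hA.join_meet_absorb hA.meet_join_absorb
  DistribLattice.ofInfSupLe fun x y z => le_of_eq (hA.distrib x y z)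

/-- The bounds of a De Morgan algebra, as bounds of its underlying lattice. -/
abbrev IsDeMorganAlgebra.boundedOrder {A : DMStr.{u}} (hA : IsDeMorganAlgebra A) :
    let := hA.distribLattice
    BoundedOrder A.carrier :=
  let := hA.distribLattice
  { top := A.top
    bot := A.bot
    le_top := fun x => sup_eq_left.1 (hA.top_join x)
    bot_le := fun x => inf_eq_left.1 (hA.bot_meet x) }

/-- The fragment of the theory of involutive Stone algebras that is used below, over a Mathlib
lattice. `n` is the De Morgan negation and `d` is the operation `∇`. -/
structure IsStoneNabla {α : Type u} [DistribLattice α] [BoundedOrder α] (n d : α → α) : Prop where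
  n_sup : ∀ x y, n (x ⊔ y) = n x ⊓ n y
  n_inf : ∀ x y, n (x ⊓ y) = n x ⊔ n y
  n_n : ∀ x, n (n x) = x
  n_top : n ⊤ = ⊥
  n_bot : n ⊥ = ⊤
  d_bot : d ⊥ = ⊥
  le_d : ∀ x, x ≤ d x
  d_inf : ∀ x y, d (x ⊓ y) = d x ⊓ d y
  n_d_inf : ∀ x, n (d x) ⊓ d x = ⊥

namespace IsStoneNabla

variable {α : Type u} [DistribLattice α] [BoundedOrder α] {n d : α → α}

theorem d_mono (h : IsStoneNabla n d) {x y : α} (hxy : x ≤ y) : d x ≤ d y := by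
  rw [← inf_eq_left] at hxy ⊢
  rw [← h.d_inf, hxy]

theorem n_d_sup (h : IsStoneNabla n d) (x : α) : n (d x) ⊔ d x = ⊤ := by
  have := congrArg n (h.n_d_inf x)
  rwa [h.n_inf, h.n_n, h.n_bot, sup_comm] at this

theorem isCompl (h : IsStoneNabla n d) (x : α) : IsCompl (n (d x)) (d x) :=
  IsCompl.of_eq (h.n_d_inf x) (h.n_d_sup x)

theorem d_d_inf_d_n_d (h : IsStoneNabla n d) (x : α) : d (n (d x)) ⊓ d (d x) = ⊥ := by
  rw [← h.d_inf, h.n_d_inf, h.d_bot]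

theorem d_d (h : IsStoneNabla n d) (x : α) : d (d x) = d x := by
  refine le_antisymm ?_ (h.le_d _)
  refine (h.isCompl x).disjoint_left_iff.1 (disjoint_iff.2 ?_)
  exact eq_bot_mono (by rw [inf_comm]; exact inf_le_inf_right _ (h.le_d _)) (h.d_d_inf_d_n_d x)

theorem d_n_d (h : IsStoneNabla n d) (x : α) : d (n (d x)) = n (d x) := by
  refine le_antisymm ?_ (h.le_d _)
  refine (h.isCompl x).disjoint_right_iff.1 (disjoint_iff.2 ?_)
  rw [← h.d_d x]
  simpa [h.d_d] using h.d_d_inf_d_n_d x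

/-- `∇` preserves joins: `∇x ∨ ∇y` is complemented and its complement is fixed by `∇`, so it is
itself fixed by `∇`. -/
theorem d_sup_le (h : IsStoneNabla n d) (x y : α) : d (x ⊔ y) ≤ d x ⊔ d y := by
  refine (h.d_mono (sup_le_sup (h.le_d x) (h.le_d y))).trans ?_
  have hc : IsCompl (n (d x) ⊓ n (d y)) (d x ⊔ d y) := (h.isCompl x).inf_sup (h.isCompl y)
  refine hc.disjoint_left_iff.1 (disjoint_iff.2 ?_)
  have : d ((d x ⊔ d y) ⊓ (n (d x) ⊓ n (d y))) = ⊥ := by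
    rw [inf_comm, hc.inf_eq_bot, h.d_bot]
  rwa [h.d_inf, h.d_inf (n (d x)), h.d_n_d, h.d_n_d] at this

end IsStoneNabla

theorem IsISAlgebra.isStoneNabla (hA : IsISAlgebra A) :
    let := hA.distribLattice
    let := hA.boundedOrder
    IsStoneNabla A.neg A.nabla :=
  let := hA.distribLattice
  let := hA.boundedOrder
  { n_sup := hA.neg_join
    n_inf := hA.neg_meet
    n_n := hA.neg_neg
    n_top := hA.neg_top
    n_bot := hA.neg_bot
    d_bot := hA.nabla_bot
    le_d := fun x => inf_eq_left.1 (hA.meet_nabla x).symm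
    d_inf := hA.nabla_meet
    n_d_inf := hA.neg_nabla_meet }

end Algebra

/-! ### Evaluation of formulas -/

theorem eval_subst (A : ISStr.{u}) (h : ℕ → A.carrier) (σ : ℕ → Fm) (φ : Fm) :
    (φ.subst σ).eval A h = φ.eval A fun n => (σ n).eval A h := by
  induction φ <;> simp_all [Fm.subst, Fm.eval]

theorem IsHom.map_eval {A : ISStr.{u}} {B : ISStr.{v}} {f : A.carrier → B.carrier}
    (hf : IsHom A B f) (h : ℕ → A.carrier) (φ : Fm) :
    f (φ.eval A h) = φ.eval B fun n => f (h n) := by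
  induction φ <;>
    simp_all [Fm.eval, hf.map_meet, hf.map_join, hf.map_neg, hf.map_nabla, hf.map_bot, hf.map_top]

theorem ISStr.eval_prod {I : Type u} (A : I → ISStr.{u}) (h : ℕ → (ISStr.prod A).carrier)
    (φ : Fm) (i : I) : φ.eval (ISStr.prod A) h i = φ.eval (A i) fun n => h n i := by
  induction φ <;> simp_all [Fm.eval, ISStr.prod]

/-- Identities are inherited by the variety generated by a class. -/
theorem ValidIdentity.varietyOf {K : Set ISStr.{u}} {s t : Fm} (hK : ValidIdentity K s t) :
    ValidIdentity (varietyOf K) s t := by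
  intro A hA
  induction hA with
  | base A hA => exact hK A hA
  | image A B f hf hs _ ih =>
    intro h
    choose g hg using fun n => hs (h n)
    obtain rfl : (fun n => f (g n)) = h := funext hg
    rw [← hf.map_eval, ← hf.map_eval, ih]
  | sub A B f hf hi _ ih =>
    intro h
    apply hi
    rw [hf.map_eval, hf.map_eval, ih]
  | prod I A _ ih =>
    intro h
    funext i
    rw [ISStr.eval_prod, ISStr.eval_prod, ih i]

theorem validIdentity_isoCopies {A : ISStr.{v}} {s t : Fm}
    (hA : ∀ h : ℕ → A.carrier, s.eval A h = t.eval A h) :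
    ValidIdentity (isoCopies.{u} A) s t := by
  rintro B ⟨f, hf, hb⟩ h
  choose g hg using fun n => hb.2 (h n)
  obtain rfl : (fun n => f (g n)) = h := funext hg
  rw [← hf.map_eval, ← hf.map_eval, hA]

/-- A copy of an algebra in a higher universe. -/
def ISStr.ulift (A : ISStr.{v}) : ISStr.{max v u} where
  carrier := ULift.{u} A.carrier
  meet := fun x y => ⟨A.meet x.down y.down⟩
  join := fun x y => ⟨A.join x.down y.down⟩
  neg := fun x => ⟨A.neg x.down⟩
  bot := ⟨A.bot⟩
  top := ⟨A.top⟩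
  nabla := fun x => ⟨A.nabla x.down⟩

theorem ISStr.isHom_up (A : ISStr.{v}) : IsHom A (ISStr.ulift.{u} A) ULift.up := by
  constructor <;> intros <;> rfl

theorem eval_eq_of_ulift {A : ISStr.{v}} {s t : Fm}
    (hst : ∀ h, s.eval (ISStr.ulift.{u} A) h = t.eval (ISStr.ulift.{u} A) h)
    (h : ℕ → A.carrier) : s.eval A h = t.eval A h := by
  have := hst fun n => ULift.up (h n)
  have up := A.isHom_up.{u, v}.map_eval h
  exact ULift.up_injective ((up s).trans (this.trans (up t).symm))

theorem isISAlgebra_ulift_IS3 : IsISAlgebra (ISStr.ulift.{u} IS3) := by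
  constructor
  · constructor
    all_goals first
      | rfl
      | (rintro ⟨_ | ⟨⟩ | _⟩ <;> rfl)
      | (rintro ⟨_ | ⟨⟩ | _⟩ ⟨_ | ⟨⟩ | _⟩ <;> rfl)
      | (rintro ⟨_ | ⟨⟩ | _⟩ ⟨_ | ⟨⟩ | _⟩ ⟨_ | ⟨⟩ | _⟩ <;> rfl)
  all_goals first
    | rfl
    | (rintro ⟨_ | ⟨⟩ | _⟩ <;> rfl)
    | (rintro ⟨_ | ⟨⟩ | _⟩ ⟨_ | ⟨⟩ | _⟩ <;> rfl)

theorem eval_IS3_of_validIdentity_ISClass {s t : Fm} (hst : ValidIdentity ISClass.{u} s t)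
    (h : ℕ → IS3.carrier) : s.eval IS3 h = t.eval IS3 h :=
  eval_eq_of_ulift.{u} (hst _ isISAlgebra_ulift_IS3) h

theorem eval_IS3_of_validIdentity_variety {s t : Fm}
    (hst : ValidIdentity (varietyOf (isoCopies.{u} IS3)) s t)
    (h : ℕ → IS3.carrier) : s.eval IS3 h = t.eval IS3 h :=
  eval_eq_of_ulift.{u} (hst _ (.base _ ⟨_, IS3.isHom_up, ULift.up_bijective⟩)) h

/-! ### Logics of matrices -/

theorem isLogic_Log (M : Set LMatrix.{u}) : IsLogic (Log M) where
  identity Γ φ hφ m hm h hΓ := hΓ φ hφ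
  monotone Γ Δ φ hΓΔ hφ m hm h hΔ := hφ m hm h fun γ hγ => hΔ γ (hΓΔ hγ)
  cut Γ Δ φ hΔ hφ m hm h hΓ := hφ m hm h fun ψ hψ => hΔ ψ hψ m hm h hΓ
  structural σ Γ φ hφ m hm h hΓ := by
    rw [eval_subst]
    refine hφ m hm _ fun γ hγ => ?_
    rw [← eval_subst]
    exact hΓ _ ⟨γ, hγ, rfl⟩

/-- Strict surjective homomorphisms of matrices preserve and reflect the logic. -/
theorem Log_eq_of_strict_surjective {A : ISStr.{u}} {B : ISStr.{v}} {f : A.carrier → B.carrier}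
    (hf : IsHom A B f) (hs : Function.Surjective f) {D : Set A.carrier} {E : Set B.carrier}
    (hDE : ∀ x, x ∈ D ↔ f x ∈ E) : Log {⟨A, D⟩} = Log {⟨B, E⟩} := by
  funext Γ φ
  refine propext ⟨?_, ?_⟩
  · rintro H m rfl h hΓ
    choose g hg using fun n => hs (h n)
    obtain rfl : (fun n => f (g n)) = h := funext hg
    have := H _ rfl g fun γ hγ => (hDE _).2 (by rw [hf.map_eval]; exact hΓ γ hγ)
    rw [← hf.map_eval]
    exact (hDE _).1 this
  · rintro H m rfl h hΓ
    refine (hDE _).2 ?_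
    rw [hf.map_eval]
    refine H _ rfl _ fun γ hγ => ?_
    rw [← hf.map_eval]
    exact (hDE _).1 (hΓ γ hγ)

/-- The map `A^∇ → IS₃` that identifies all elements of `A`. -/
def collapse (A : DMStr.{u}) : A.withNabla.carrier → IS3.carrier
  | .bbot => .bbot
  | .elem _ => .elem ()
  | .ttop => .ttop

theorem isHom_collapse (A : DMStr.{u}) : IsHom A.withNabla IS3 (collapse A) := by
  constructor
  · rintro (_ | x | _) (_ | y | _) <;> rfl
  · rintro (_ | x | _) (_ | y | _) <;> rfl
  · rintro (_ | x | _) <;> rfl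
  · rintro (_ | x | _) <;> rfl
  · rfl
  · rfl

theorem collapse_surjective (A : DMStr.{u}) : Function.Surjective (collapse A) := by
  rintro (_ | ⟨⟩ | _)
  exacts [⟨.bbot, rfl⟩, ⟨.elem A.bot, rfl⟩, ⟨.ttop, rfl⟩]

theorem mem_withNabla_up {A : DMStr.{u}} (hA : ∀ x, A.meet A.bot x = A.bot)
    (x : A.withNabla.carrier) : x ∈ A.withNabla.up A.zeroIn ↔ x ≠ Adj.bbot := by
  rcases x with _ | x | _
  · exact ⟨nofun, fun h => (h rfl).elim⟩
  · exact ⟨fun _ => nofun, fun _ => congrArg Adj.elem (hA x)⟩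
  · exact ⟨fun _ => nofun, fun _ => rfl⟩

theorem mem_IS3_up {x : IS3.carrier} : x ∈ IS3.up T1.zeroIn ↔ x ≠ Adj.bbot :=
  mem_withNabla_up (fun _ => rfl) x

theorem mem_IS3_top {x : IS3.carrier} : x ∈ ({IS3.top} : Set IS3.carrier) ↔ x = Adj.ttop :=
  Iff.rfl

theorem Log_withNabla_top (A : DMStr.{u}) :
    Log {⟨A.withNabla, {A.withNabla.top}⟩} = Log {⟨IS3, {IS3.top}⟩} := by
  refine Log_eq_of_strict_surjective (isHom_collapse A) (collapse_surjective A) fun x => ?_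
  rw [mem_IS3_top]
  change x = Adj.ttop ↔ _
  rcases x with _ | x | _
  exacts [iff_of_false nofun nofun, iff_of_false nofun nofun, iff_of_true rfl rfl]

theorem Log_withNabla_up (A : DMStr.{u}) (hA : ∀ x, A.meet A.bot x = A.bot) :
    Log {⟨A.withNabla, A.withNabla.up A.zeroIn⟩} = Log {⟨IS3, IS3.up T1.zeroIn⟩} := by
  refine Log_eq_of_strict_surjective (isHom_collapse A) (collapse_surjective A) fun x => ?_
  rw [mem_IS3_up, mem_withNabla_up hA]
  rcases x with _ | x | _
  exacts [iff_of_false (· rfl) (· rfl), iff_of_true nofun nofun, iff_of_true nofun nofun]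

/-- A set of designated values that contains the top and is closed under meets and upwards. -/
structure IsMatrixFilter (A : ISStr.{u}) (D : Set A.carrier) : Prop where
  top_mem : A.top ∈ D
  meet_mem : ∀ x y, x ∈ D → y ∈ D → A.meet x y ∈ D
  up_mem : ∀ x y, x ∈ D → A.meet x y = x → y ∈ D

theorem IsMatrixFilter.foldl_mem {A : ISStr.{u}} {D : Set A.carrier} (hD : IsMatrixFilter A D)
    (h : ℕ → A.carrier) (l : List Fm) : ∀ γ : Fm, γ.eval A h ∈ D → (∀ δ ∈ l, δ.eval A h ∈ D) →
      (l.foldl Fm.meet γ).eval A h ∈ D := by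
  induction l with
  | nil => exact fun γ hγ _ => hγ
  | cons δ l ih =>
    exact fun γ hγ hl => ih _ (hD.meet_mem _ _ hγ (hl δ (by simp)))
      fun ε hε => hl ε (by simp [hε])

theorem orderPreserving_le_Log {K : Set ISStr.{u}} {M : Set LMatrix.{v}}
    (hK : ∀ m ∈ M, ∀ s t, ValidIdentity K s t → ∀ h, s.eval m.alg h = t.eval m.alg h)
    (hM : ∀ m ∈ M, IsMatrixFilter m.alg m.designated) {Γ : Set Fm} {φ : Fm}
    (hφ : orderPreserving K Γ φ) : Log M Γ φ := by
  intro m hm h hΓ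
  obtain ⟨-, hφ⟩ | ⟨-, γ, l, hγ, hl, hφ⟩ := hφ
  · rw [hK m hm _ _ hφ]
    exact (hM m hm).top_mem
  · exact (hM m hm).up_mem _ _ ((hM m hm).foldl_mem h l γ (hΓ γ hγ) fun δ hδ => hΓ δ (hl δ hδ))
      (hK m hm _ _ hφ h)

theorem IsISAlgebra.isMatrixFilter_top {A : ISStr.{u}} (hA : IsISAlgebra A) :
    IsMatrixFilter A {A.top} := by
  let := hA.distribLattice
  let := hA.boundedOrder
  refine ⟨rfl, ?_, ?_⟩
  · rintro _ _ rfl rfl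
    exact inf_idem (⊤ : A.carrier)
  · rintro _ y rfl hy
    exact top_le_iff.1 (inf_eq_left.1 hy : (⊤ : A.carrier) ≤ y)

theorem isMatrixFilter_IS3_top : IsMatrixFilter IS3 {IS3.top} := by
  refine ⟨rfl, ?_, ?_⟩
  · rintro _ _ rfl rfl
    rfl
  · rintro _ y rfl hy
    exact hy

theorem isMatrixFilter_IS3_up : IsMatrixFilter IS3 (IS3.up T1.zeroIn) := by
  refine ⟨rfl, ?_, ?_⟩ <;> intro x y <;> simp only [mem_IS3_up] <;>
    rcases x with _ | ⟨⟩ | _ <;> rcases y with _ | ⟨⟩ | _ <;> simp [IS3, DMStr.withNabla]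

theorem ISle_le_Log {M : Set LMatrix.{0}} (hM : ∀ m ∈ M, m = ⟨IS3, {IS3.top}⟩ ∨
    m = ⟨IS3, IS3.up T1.zeroIn⟩) {Γ : Set Fm} {φ : Fm} (hφ : ISle.{u} Γ φ) : Log M Γ φ := by
  refine orderPreserving_le_Log ?_ ?_ hφ
  · rintro m hm s t hst
    obtain rfl | rfl := hM m hm <;> exact eval_IS3_of_validIdentity_ISClass hst
  · rintro m hm
    obtain rfl | rfl := hM m hm
    exacts [isMatrixFilter_IS3_top, isMatrixFilter_IS3_up]

theorem addRules_le {L L' : Consequence} {R : Set (Set Fm × Fm)} (hL' : IsLogic L')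
    (hL : ∀ Γ φ, L Γ φ → L' Γ φ) (hR : ∀ r ∈ R, L' r.1 r.2) : ∀ Γ φ, addRules L R Γ φ → L' Γ φ :=
  fun _ _ h => h L' hL' hL hR

/-! ### Theories and prime theories -/

/-- The order of the free involutive Stone algebra, as a preorder on formulas. -/
def Le (φ ψ : Fm) : Prop := ValidIdentity ISClass.{u} (φ.meet ψ) φ

theorem le_of_forall {φ ψ : Fm} (h : ∀ (α : Type u) [DistribLattice α] [BoundedOrder α]
    (n d : α → α), IsStoneNabla n d → ∀ e : ℕ → α,
      letI A : ISStr.{u} := ⟨⟨α, (· ⊓ ·), (· ⊔ ·), n, ⊥, ⊤⟩, d⟩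
      (φ.eval A e : α) ≤ ψ.eval A e) : Le.{u} φ ψ := by
  intro A hA e
  let := hA.distribLattice
  let := hA.boundedOrder
  exact inf_eq_left.2 (h A.carrier A.neg A.nabla hA.isStoneNabla e)

/-- The interior operator `Δφ = ~∇~φ`, dual to `∇`. -/
def Fm.delta (φ : Fm) : Fm := φ.neg.nabla.neg

/-- A theory: a filter for the preorder `Le` that is closed under all rules
`α ∨ ρ ⊢ β ∨ ρ` with `R α β`. -/
structure IsTheory (R : Fm → Fm → Prop) (T : Set Fm) : Prop where
  top_mem : Fm.top ∈ T
  meet_mem : ∀ {φ ψ}, φ ∈ T → ψ ∈ T → φ.meet ψ ∈ T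
  up_mem : ∀ {φ ψ}, φ ∈ T → Le.{u} φ ψ → ψ ∈ T
  rule_mem : ∀ {α β} (ρ : Fm), R α β → α.join ρ ∈ T → β.join ρ ∈ T

/-- The formulas whose join with a fixed formula lies in a theory form a theory. This is why the
rules carry a side formula `ρ`. -/
theorem IsTheory.residual {R : Fm → Fm → Prop} {T : Set Fm} (hT : IsTheory.{u} R T) (ω : Fm) :
    IsTheory.{u} R {φ | φ.join ω ∈ T} where
  top_mem := hT.up_mem hT.top_mem <| le_of_forall fun _ _ _ _ _ _ _ => le_sup_left
  meet_mem hφ hψ := hT.up_mem (hT.meet_mem hφ hψ) <| le_of_forall fun _ _ _ _ _ _ _ =>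
    (sup_inf_right _ _ _).ge
  up_mem {φ ψ} hφ hφψ := hT.up_mem hφ <| by
    intro A hA e
    let := hA.distribLattice
    exact inf_eq_left.2 (sup_le_sup_right (inf_eq_left.1 (hφψ A hA e)) _)
  rule_mem {α β} ρ hR hα := by
    refine hT.up_mem (hT.rule_mem (ρ.join ω) hR (hT.up_mem hα ?_)) ?_
    · exact le_of_forall fun _ _ _ _ _ _ _ => (sup_assoc _ _ _).le
    · exact le_of_forall fun _ _ _ _ _ _ _ => (sup_assoc _ _ _).ge

/-- A proper theory that contains one of the formulas whenever it contains their join. -/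
structure IsPrimeTheory (R : Fm → Fm → Prop) (F : Set Fm) : Prop extends IsTheory.{u} R F where
  bot_notMem : Fm.bot ∉ F
  prime : ∀ {φ ψ}, φ.join ψ ∈ F → φ ∈ F ∨ ψ ∈ F

/-- The prime theory theorem: a theory that omits a formula `φ` extends to a prime theory that
omits `φ`. A maximal one works, since its residuals are theories. -/
theorem IsTheory.exists_isPrimeTheory {R : Fm → Fm → Prop} {T : Set Fm} (hT : IsTheory.{u} R T)
    {φ : Fm} (hφ : φ ∉ T) : ∃ F, T ⊆ F ∧ IsPrimeTheory.{u} R F ∧ φ ∉ F := by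
  obtain ⟨F, hTF, hF⟩ := zorn_subset_nonempty {F | IsTheory.{u} R F ∧ φ ∉ F} (by
    intro c hc hchain hne
    refine ⟨⋃₀ c, ⟨⟨?_, ?_, ?_, ?_⟩, ?_⟩, fun s hs => Set.subset_sUnion_of_mem hs⟩
    · obtain ⟨s, hs⟩ := hne
      exact ⟨s, hs, (hc hs).1.top_mem⟩
    · rintro α β ⟨s, hs, hα⟩ ⟨t, ht, hβ⟩
      obtain hst | hts := hchain.total hs ht
      · exact ⟨t, ht, (hc ht).1.meet_mem (hst hα) hβ⟩
      · exact ⟨s, hs, (hc hs).1.meet_mem hα (hts hβ)⟩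
    · rintro α β ⟨s, hs, hα⟩ hαβ
      exact ⟨s, hs, (hc hs).1.up_mem hα hαβ⟩
    · rintro α β ρ hR ⟨s, hs, hα⟩
      exact ⟨s, hs, (hc hs).1.rule_mem ρ hR hα⟩
    · rintro ⟨s, hs, hs'⟩
      exact (hc hs).2 hs') T ⟨hT, hφ⟩
  obtain ⟨hFT, hφF⟩ := hF.prop
  refine ⟨F, hTF, ⟨hFT, fun hb => hφF (hFT.up_mem hb ?_), ?_⟩, hφF⟩
  · exact le_of_forall fun _ _ _ _ _ _ _ => bot_le
  · intro α β hαβ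
    by_contra! hc
    -- By maximality, the residual of `F` by `ω` contains `φ` as soon as it is larger than `F`.
    have key : ∀ χ ω, χ ∉ F → χ.join ω ∈ F → φ.join ω ∈ F := by
      intro χ ω hχ hχω
      by_contra hn
      exact hχ (hF.le_of_ge ⟨hFT.residual ω, hn⟩ (fun ψ hψ => hFT.up_mem hψ <|
        le_of_forall fun _ _ _ _ _ _ _ => le_sup_left) hχω)
    have h1 : φ.join β ∈ F := key α β hc.1 hαβ
    have h2 : φ.join φ ∈ F := key β φ hc.2 <| hFT.up_mem h1 <|
      le_of_forall fun _ _ _ _ _ _ _ => (sup_comm _ _).le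
    exact hφF <| hFT.up_mem h2 <| le_of_forall fun _ _ _ _ _ _ _ => (sup_idem _).le

/-! ### The valuation of a prime theory -/

/-- The middle element of `IS₃`. -/
def IS3.mid : IS3.carrier := Adj.elem ()

open Classical in
/-- The element of `IS₃` given by a pair of truth values: `P` says whether it is `⊤`, and `P'`
whether it is different from `⊥`. -/
noncomputable def IS3.ofProps (P P' : Prop) : IS3.carrier :=
  if P then IS3.top else if P' then IS3.mid else IS3.bot

section OfProps

variable {P P' Q Q' : Prop}

theorem IS3.meet_ofProps (hP : P → P') (hQ : Q → Q') :
    IS3.meet (IS3.ofProps P P') (IS3.ofProps Q Q') = IS3.ofProps (P ∧ Q) (P' ∧ Q') := by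
  by_cases P <;> by_cases P' <;> by_cases Q <;> by_cases Q' <;> simp_all [IS3.ofProps] <;> rfl

theorem IS3.join_ofProps (hP : P → P') (hQ : Q → Q') :
    IS3.join (IS3.ofProps P P') (IS3.ofProps Q Q') = IS3.ofProps (P ∨ Q) (P' ∨ Q') := by
  by_cases P <;> by_cases P' <;> by_cases Q <;> by_cases Q' <;> simp_all [IS3.ofProps] <;> rfl

theorem IS3.neg_ofProps (hP : P → P') :
    IS3.neg (IS3.ofProps P P') = IS3.ofProps (¬P') (¬P) := by
  by_cases P <;> by_cases P' <;> simp_all [IS3.ofProps] <;> rfl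

theorem IS3.nabla_ofProps (hP : P → P') : IS3.nabla (IS3.ofProps P P') = IS3.ofProps P' P' := by
  by_cases P <;> by_cases P' <;> simp_all [IS3.ofProps] <;> rfl

theorem IS3.ofProps_mem_top : IS3.ofProps P P' ∈ ({IS3.top} : Set IS3.carrier) ↔ P := by
  rw [mem_IS3_top, IS3.ofProps]
  split_ifs with h1 h2
  exacts [iff_of_true rfl h1, iff_of_false nofun h1, iff_of_false nofun h1]

theorem IS3.ofProps_mem_up (hP : P → P') : IS3.ofProps P P' ∈ IS3.up T1.zeroIn ↔ P' := by
  rw [mem_IS3_up, IS3.ofProps]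
  split_ifs with h1 h2
  exacts [iff_of_true nofun (hP h1), iff_of_true nofun h2, iff_of_false (· rfl) h2]

end OfProps

/-- The three-valued valuation of a set of formulas: `⊤` if it contains `Δφ`, the middle element
if it contains `∇φ` but not `Δφ`, and `⊥` otherwise. -/
noncomputable def valuation (F : Set Fm) (φ : Fm) : IS3.carrier :=
  IS3.ofProps (φ.delta ∈ F) (φ.nabla ∈ F)

namespace IsPrimeTheory

variable {R : Fm → Fm → Prop} {F : Set Fm} {φ ψ : Fm}

theorem meet_mem_iff (hF : IsPrimeTheory.{u} R F) : φ.meet ψ ∈ F ↔ φ ∈ F ∧ ψ ∈ F :=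
  ⟨fun h => ⟨hF.up_mem h <| le_of_forall fun _ _ _ _ _ _ _ => inf_le_left,
    hF.up_mem h <| le_of_forall fun _ _ _ _ _ _ _ => inf_le_right⟩,
    fun h => hF.meet_mem h.1 h.2⟩

theorem join_mem_iff (hF : IsPrimeTheory.{u} R F) : φ.join ψ ∈ F ↔ φ ∈ F ∨ ψ ∈ F :=
  ⟨hF.prime, fun h => h.elim
    (fun h => hF.up_mem h <| le_of_forall fun _ _ _ _ _ _ _ => le_sup_left)
    (fun h => hF.up_mem h <| le_of_forall fun _ _ _ _ _ _ _ => le_sup_right)⟩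

theorem neg_nabla_mem_iff (hF : IsPrimeTheory.{u} R F) : φ.nabla.neg ∈ F ↔ φ.nabla ∉ F := by
  constructor
  · intro h1 h2
    exact hF.bot_notMem <| hF.up_mem (hF.meet_mem h1 h2) <|
      le_of_forall fun _ _ _ _ _ h _ => (h.n_d_inf _).le
  · intro h
    refine (hF.join_mem_iff.1 (hF.up_mem hF.top_mem ?_)).resolve_right h
    exact le_of_forall fun _ _ _ _ _ h _ => (h.n_d_sup _).ge

theorem nabla_meet_mem_iff (hF : IsPrimeTheory.{u} R F) :
    (φ.meet ψ).nabla ∈ F ↔ φ.nabla ∈ F ∧ ψ.nabla ∈ F := by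
  rw [← hF.meet_mem_iff]
  exact ⟨fun h => hF.up_mem h <| le_of_forall fun _ _ _ _ _ h _ => (h.d_inf _ _).le,
    fun h => hF.up_mem h <| le_of_forall fun _ _ _ _ _ h _ => (h.d_inf _ _).ge⟩

theorem nabla_join_mem_iff (hF : IsPrimeTheory.{u} R F) :
    (φ.join ψ).nabla ∈ F ↔ φ.nabla ∈ F ∨ ψ.nabla ∈ F := by
  rw [← hF.join_mem_iff]
  exact ⟨fun h => hF.up_mem h <| le_of_forall fun _ _ _ _ _ h _ => h.d_sup_le _ _,
    fun h => hF.up_mem h <| le_of_forall fun _ _ _ _ _ h _ =>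
      sup_le (h.d_mono le_sup_left) (h.d_mono le_sup_right)⟩

theorem nabla_congr (hF : IsPrimeTheory.{u} R F) (h₁ : Le.{u} φ ψ) (h₂ : Le.{u} ψ φ) :
    φ.nabla ∈ F ↔ ψ.nabla ∈ F := by
  have mono : ∀ {χ ω : Fm}, Le.{u} χ ω → Le.{u} χ.nabla ω.nabla := by
    intro χ ω h A hA e
    let := hA.distribLattice
    let := hA.boundedOrder
    exact inf_eq_left.2 (hA.isStoneNabla.d_mono (inf_eq_left.1 (h A hA e)))
  exact ⟨fun h => hF.up_mem h (mono h₁), fun h => hF.up_mem h (mono h₂)⟩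

theorem delta_mem_iff (hF : IsPrimeTheory.{u} R F) : φ.delta ∈ F ↔ φ.neg.nabla ∉ F :=
  hF.neg_nabla_mem_iff

theorem delta_meet_mem_iff (hF : IsPrimeTheory.{u} R F) :
    (φ.meet ψ).delta ∈ F ↔ φ.delta ∈ F ∧ ψ.delta ∈ F := by
  rw [hF.delta_mem_iff, hF.delta_mem_iff, hF.delta_mem_iff, ← not_or, ← hF.nabla_join_mem_iff,
    hF.nabla_congr]
  · exact le_of_forall fun _ _ _ _ _ h _ => (h.n_inf _ _).le
  · exact le_of_forall fun _ _ _ _ _ h _ => (h.n_inf _ _).ge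

theorem delta_join_mem_iff (hF : IsPrimeTheory.{u} R F) :
    (φ.join ψ).delta ∈ F ↔ φ.delta ∈ F ∨ ψ.delta ∈ F := by
  rw [hF.delta_mem_iff, hF.delta_mem_iff, hF.delta_mem_iff, ← not_and_or, ← hF.nabla_meet_mem_iff,
    hF.nabla_congr]
  · exact le_of_forall fun _ _ _ _ _ h _ => (h.n_sup _ _).le
  · exact le_of_forall fun _ _ _ _ _ h _ => (h.n_sup _ _).ge

theorem delta_neg_mem_iff (hF : IsPrimeTheory.{u} R F) : φ.neg.delta ∈ F ↔ φ.nabla ∉ F := by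
  rw [hF.delta_mem_iff, hF.nabla_congr]
  · exact le_of_forall fun _ _ _ _ _ h _ => (h.n_n _).le
  · exact le_of_forall fun _ _ _ _ _ h _ => (h.n_n _).ge

theorem nabla_neg_mem_iff (hF : IsPrimeTheory.{u} R F) : φ.neg.nabla ∈ F ↔ φ.delta ∉ F := by
  rw [hF.delta_mem_iff, not_not]

theorem nabla_nabla_mem_iff (hF : IsPrimeTheory.{u} R F) : φ.nabla.nabla ∈ F ↔ φ.nabla ∈ F :=
  ⟨fun h => hF.up_mem h <| le_of_forall fun _ _ _ _ _ h _ => (h.d_d _).le,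
    fun h => hF.up_mem h <| le_of_forall fun _ _ _ _ _ h _ => (h.d_d _).ge⟩

theorem delta_nabla_mem_iff (hF : IsPrimeTheory.{u} R F) : φ.nabla.delta ∈ F ↔ φ.nabla ∈ F := by
  rw [hF.delta_mem_iff, ← not_iff_not, not_not, ← hF.neg_nabla_mem_iff]
  exact ⟨fun h => hF.up_mem h <| le_of_forall fun _ _ _ _ _ h _ => (h.d_n_d _).le,
    fun h => hF.up_mem h <| le_of_forall fun _ _ _ _ _ h _ => (h.d_n_d _).ge⟩

theorem nabla_bot_notMem (hF : IsPrimeTheory.{u} R F) : Fm.bot.nabla ∉ F := fun h =>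
  hF.bot_notMem <| hF.up_mem h <| le_of_forall fun _ _ _ _ _ h _ => h.d_bot.le

theorem nabla_mem (hF : IsPrimeTheory.{u} R F) (h : φ ∈ F) : φ.nabla ∈ F :=
  hF.up_mem h <| le_of_forall fun _ _ _ _ _ h _ => h.le_d _

theorem mem_of_delta_mem (hF : IsPrimeTheory.{u} R F) (h : φ.delta ∈ F) : φ ∈ F :=
  hF.up_mem h <| le_of_forall fun α _ _ n d h e => by
    have := h.le_d (n (φ.eval ⟨⟨α, (· ⊓ ·), (· ⊔ ·), n, ⊥, ⊤⟩, d⟩ e))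
    rw [← sup_eq_right] at this
    have := congrArg n this
    rw [h.n_sup, h.n_n] at this
    exact inf_eq_right.1 this

theorem delta_top_mem (hF : IsPrimeTheory.{u} R F) : Fm.top.delta ∈ F := by
  rw [hF.delta_mem_iff, hF.nabla_congr (ψ := .bot)]
  · exact hF.nabla_bot_notMem
  · exact le_of_forall fun _ _ _ _ _ h _ => h.n_top.le
  · exact le_of_forall fun _ _ _ _ _ h _ => h.n_top.ge

theorem delta_bot_notMem (hF : IsPrimeTheory.{u} R F) : Fm.bot.delta ∉ F := fun h =>
  hF.bot_notMem (hF.mem_of_delta_mem h)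

/-- A prime theory satisfies the side-formula-free form of the rules it is closed under. -/
theorem rule (hF : IsPrimeTheory.{u} R F) (hR : R φ ψ) (h : φ ∈ F) : ψ ∈ F :=
  (hF.join_mem_iff.1 (hF.rule_mem ψ hR (hF.join_mem_iff.2 (.inl h)))).elim id id

theorem nabla_mem_of_delta_mem (hF : IsPrimeTheory.{u} R F) (h : φ.delta ∈ F) : φ.nabla ∈ F :=
  hF.nabla_mem (hF.mem_of_delta_mem h)

theorem eval_valuation (hF : IsPrimeTheory.{u} R F) (φ : Fm) :
    φ.eval IS3 (fun n => valuation F (.var n)) = valuation F φ := by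
  induction φ with
  | var n => rfl
  | meet φ ψ ihφ ihψ =>
    rw [Fm.eval, ihφ, ihψ, valuation, valuation, valuation, hF.delta_meet_mem_iff,
      hF.nabla_meet_mem_iff, IS3.meet_ofProps hF.nabla_mem_of_delta_mem hF.nabla_mem_of_delta_mem]
  | join φ ψ ihφ ihψ =>
    rw [Fm.eval, ihφ, ihψ, valuation, valuation, valuation, hF.delta_join_mem_iff,
      hF.nabla_join_mem_iff, IS3.join_ofProps hF.nabla_mem_of_delta_mem hF.nabla_mem_of_delta_mem]
  | neg φ ih =>
    rw [Fm.eval, ih, valuation, valuation, hF.delta_neg_mem_iff, hF.nabla_neg_mem_iff,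
      IS3.neg_ofProps hF.nabla_mem_of_delta_mem]
  | nabla φ ih =>
    rw [Fm.eval, ih, valuation, valuation, hF.delta_nabla_mem_iff, hF.nabla_nabla_mem_iff,
      IS3.nabla_ofProps hF.nabla_mem_of_delta_mem]
  | bot => exact ((if_neg hF.delta_bot_notMem).trans (if_neg hF.nabla_bot_notMem)).symm
  | top => exact (if_pos hF.delta_top_mem).symm

theorem eval_valuation_mem_top (hF : IsPrimeTheory.{u} R F) :
    φ.eval IS3 (fun n => valuation F (.var n)) ∈ ({IS3.top} : Set IS3.carrier) ↔ φ.delta ∈ F := by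
  rw [hF.eval_valuation, valuation, IS3.ofProps_mem_top]

theorem eval_valuation_mem_up (hF : IsPrimeTheory.{u} R F) :
    φ.eval IS3 (fun n => valuation F (.var n)) ∈ IS3.up T1.zeroIn ↔ φ.nabla ∈ F := by
  rw [hF.eval_valuation, valuation, IS3.ofProps_mem_up hF.nabla_mem_of_delta_mem]

end IsPrimeTheory

/-! ### Completeness -/

/-- The deductive closure of a set of formulas under an extension of `IS_≤` is a theory. -/
theorem isTheory_closure {L : Consequence} (hL : IsLogic L) (hIS : ∀ Γ φ, ISle.{u} Γ φ → L Γ φ)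
    {R : Fm → Fm → Prop} (hR : ∀ α β ρ, R α β → L {α.join ρ} (β.join ρ)) (Γ : Set Fm) :
    IsTheory.{u} R {φ | L Γ φ} where
  top_mem := hL.monotone _ _ _ (Set.empty_subset Γ) (hIS _ _ (.inl ⟨rfl, fun _ _ _ => rfl⟩))
  meet_mem {φ ψ} hφ hψ := by
    refine hL.cut Γ {φ, ψ} _ (by rintro _ (rfl | rfl) <;> assumption) (hIS _ _ (.inr
      ⟨(Set.insert_nonempty _ _).ne_empty, φ, [ψ], by simp, by simp, ?_⟩))
    intro A hA h
    let := hA.distribLattice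
    exact inf_idem (A.meet (φ.eval A h) (ψ.eval A h))
  up_mem {φ ψ} hφ hφψ :=
    hL.cut Γ {φ} _ (by rintro _ rfl; exact hφ)
      (hIS _ _ (.inr ⟨by simp, φ, [], by simp, by simp, hφψ⟩))
  rule_mem {α β} ρ hαβ hα := hL.cut Γ {α.join ρ} _ (by rintro _ rfl; exact hα) (hR α β ρ hαβ)

/-- The substitution that sends `p, q, r` to the given formulas. -/
def substPQR (α β ρ : Fm) : ℕ → Fm
  | 0 => α
  | 1 => β
  | _ => ρ

theorem Log_IS3_top_le_addRules (Γ : Set Fm) (φ : Fm) (hφ : Log {⟨IS3, {IS3.top}⟩} Γ φ) :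
    addRules ISle.{u} {ruleOne} Γ φ := by
  intro L hL hIS hR
  by_contra hn
  have hT := isTheory_closure hL hIS (R := fun _ _ => False) (by simp) Γ
  obtain ⟨F, hTF, hF, hφF⟩ := hT.exists_isPrimeTheory hn
  refine hφF (hF.mem_of_delta_mem (hF.eval_valuation_mem_top.1 (hφ _ rfl _ fun γ hγ => ?_)))
  refine hF.eval_valuation_mem_top.2 (hTF ?_)
  have := hL.structural (substPQR γ γ γ) _ _ (hR _ rfl)
  rw [ruleOne, Set.image_singleton] at this
  exact hL.monotone _ _ _ (by rintro _ rfl; exact hγ) this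

theorem Log_IS3_up_le_addRules (Γ : Set Fm) (φ : Fm)
    (hφ : Log {⟨IS3, IS3.up T1.zeroIn⟩} Γ φ) : addRules ISle.{u} {axiomNabla} Γ φ := by
  intro L hL hIS hR
  by_contra hn
  have hT := isTheory_closure hL hIS (R := fun _ _ => False) (by simp) Γ
  obtain ⟨F, hTF, hF, hφF⟩ := hT.exists_isPrimeTheory hn
  have h1 : φ.nabla ∈ F := hF.eval_valuation_mem_up.1 <| hφ _ rfl _ fun γ hγ =>
    hF.eval_valuation_mem_up.2 (hF.nabla_mem (hTF (hL.identity _ _ hγ)))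
  have h2 : φ.join φ.nabla.neg ∈ F := hTF <| by
    have := hL.structural (substPQR φ φ φ) _ _ (hR _ rfl)
    rw [axiomNabla, Set.image_empty] at this
    exact hL.monotone _ _ _ (Set.empty_subset _) this
  rw [hF.join_mem_iff, hF.neg_nabla_mem_iff] at h2
  exact h2.elim hφF fun h => h h1

/-- The inequalities `α ∧ ~α ≤ β ∨ ~β` and `~α ∧ ∇α ≤ α` of `IS₃`, read as rules. -/
inductive ThreeRule : Fm → Fm → Prop
  | kleene (α β : Fm) : ThreeRule (α.meet α.neg) (β.join β.neg)
  | fixed (α : Fm) : ThreeRule (α.neg.meet α.nabla) α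

/-- A prime theory closed under `ThreeRule` is closed under `Δ`, or contains each formula whose
`∇` it contains; so it is the preimage of `{⊤}` or of `↑0` under its valuation. -/
theorem IsPrimeTheory.delta_or_nabla {F : Set Fm} (hF : IsPrimeTheory.{u} ThreeRule F) :
    (∀ φ ∈ F, φ.delta ∈ F) ∨ ∀ φ, φ.nabla ∈ F → φ ∈ F := by
  by_contra! h
  obtain ⟨⟨φ, hφ, hφ'⟩, ψ, hψ, hψ'⟩ := h
  have hnn : φ.neg.neg ∈ F := hF.up_mem hφ <|
    le_of_forall fun _ _ _ _ _ h _ => (h.n_n _).ge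
  have hn : φ.neg ∈ F :=
    hF.rule (.fixed φ.neg) (hF.meet_mem hnn (hF.nabla_neg_mem_iff.2 hφ'))
  have hψn : ψ.neg ∈ F :=
    (hF.join_mem_iff.1 (hF.rule (.kleene φ ψ) (hF.meet_mem hφ hn))).resolve_left hψ'
  exact hψ' (hF.rule (.fixed ψ) (hF.meet_mem hψn hψ))

theorem Log_IS3_pair_le_addRules (Γ : Set Fm) (φ : Fm)
    (hφ : Log {⟨IS3, {IS3.top}⟩, ⟨IS3, IS3.up T1.zeroIn⟩} Γ φ) :
    addRules ISle.{u} {ruleKleene, ruleA, ruleB} Γ φ := by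
  intro L hL hIS hR
  by_contra hn
  have hT : IsTheory.{u} ThreeRule {ψ | L Γ ψ} := by
    refine isTheory_closure hL hIS ?_ Γ
    rintro _ α ρ (⟨β, γ⟩ | _)
    · have := hL.structural (substPQR β γ ρ) _ _ (hR ruleKleene (by simp))
      rwa [ruleKleene, Set.image_singleton] at this
    · have := hL.structural (substPQR α α ρ) _ _ (hR ruleA (by simp))
      rw [ruleA, Set.image_pair] at this
      have hC := isTheory_closure hL hIS (R := fun _ _ => False) (by simp)
        {(α.neg.meet α.nabla).join ρ}
      refine hL.cut _ _ _ ?_ this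
      rintro _ (rfl | rfl)
      · exact hC.up_mem (hL.identity _ _ rfl) <|
          le_of_forall fun _ _ _ _ _ _ _ => sup_le_sup_right inf_le_left _
      · exact hC.up_mem (hL.identity _ _ rfl) <|
          le_of_forall fun _ _ _ _ _ _ _ => sup_le_sup_right inf_le_right _
  obtain ⟨F, hTF, hF, hφF⟩ := hT.exists_isPrimeTheory hn
  have hΓ : ∀ γ ∈ Γ, γ ∈ F := fun γ hγ => hTF (hL.identity _ _ hγ)
  obtain hΔ | hN := hF.delta_or_nabla
  · exact hφF <| hF.mem_of_delta_mem <| hF.eval_valuation_mem_top.1 <|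
      hφ ⟨IS3, {IS3.top}⟩ (by simp) _ fun γ hγ =>
        hF.eval_valuation_mem_top.2 (hΔ γ (hΓ γ hγ))
  · exact hφF <| hN _ <| hF.eval_valuation_mem_up.1 <|
      hφ ⟨IS3, IS3.up T1.zeroIn⟩ (by simp) _ fun γ hγ =>
        hF.eval_valuation_mem_up.2 (hF.nabla_mem (hΓ γ hγ))

/-! ### Soundness -/

theorem addRules_ruleOne_le_oneAssertional (Γ : Set Fm) (φ : Fm)
    (hφ : addRules ISle.{u} {ruleOne} Γ φ) : oneAssertional ISClass.{u} Γ φ := by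
  refine addRules_le (isLogic_Log _) (fun Γ φ => orderPreserving_le_Log ?_ ?_) ?_ Γ φ hφ
  · rintro _ ⟨A, hA, rfl⟩ s t hst
    exact hst A hA
  · rintro _ ⟨A, hA, rfl⟩
    exact IsISAlgebra.isMatrixFilter_top hA
  · rintro _ rfl _ ⟨A, hA, rfl⟩ h hp
    have hA : IsISAlgebra A := hA
    have hp : h 0 = A.top := hp p rfl
    change A.neg (A.nabla (A.neg (h 0))) = A.top
    rw [hp, hA.neg_top, hA.nabla_bot, hA.neg_bot]

theorem oneAssertional_le_Log_IS3 (Γ : Set Fm) (φ : Fm) (hφ : oneAssertional ISClass.{u} Γ φ) :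
    Log {⟨IS3, {IS3.top}⟩} Γ φ := by
  rintro _ rfl h hΓ
  have := hφ _ ⟨_, isISAlgebra_ulift_IS3.{u}, rfl⟩ (fun n => ⟨h n⟩) fun γ hγ => by
    change γ.eval (ISStr.ulift.{u} IS3) (fun n => ULift.up (h n)) = ULift.up IS3.top
    rw [← IS3.isHom_up.map_eval]
    exact congrArg _ (hΓ γ hγ)
  change φ.eval (ISStr.ulift.{u} IS3) (fun n => ULift.up (h n)) = ULift.up IS3.top at this
  rw [← IS3.isHom_up.map_eval] at this
  exact ULift.up_injective this

theorem addRules_axiomNabla_le_Log_IS3 (Γ : Set Fm) (φ : Fm)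
    (hφ : addRules ISle.{u} {axiomNabla} Γ φ) : Log {⟨IS3, IS3.up T1.zeroIn⟩} Γ φ := by
  refine addRules_le (isLogic_Log _) (fun Γ φ => ISle_le_Log (by simp)) ?_ Γ φ hφ
  rintro _ rfl _ rfl h -
  change IS3.join (h 0) (IS3.neg (IS3.nabla (h 0))) ∈ IS3.up T1.zeroIn
  rcases h 0 with _ | ⟨⟩ | _ <;> rfl

/-- The finitary companion of a logic. -/
def finitary (L : Consequence) : Consequence := fun Γ φ => ∃ Δ, Δ.Finite ∧ Δ ⊆ Γ ∧ L Δ φ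

theorem IsLogic.finitary {L : Consequence} (hL : IsLogic L) : IsLogic (finitary L) where
  identity Γ φ hφ := ⟨{φ}, Set.finite_singleton φ, by simpa using hφ, hL.identity _ _ rfl⟩
  monotone := by
    rintro Γ Γ' φ hΓ ⟨Δ, hfin, hΔ, hφ⟩
    exact ⟨Δ, hfin, hΔ.trans hΓ, hφ⟩
  cut := by
    rintro Γ Γ' φ hΓ ⟨Δ, hfin, hΔ, hφ⟩
    choose! S hS using hΓ
    refine ⟨⋃ ψ ∈ Δ, S ψ, hfin.biUnion fun ψ hψ => (hS ψ (hΔ hψ)).1,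
      Set.iUnion₂_subset fun ψ hψ => (hS ψ (hΔ hψ)).2.1, hL.cut _ Δ _ (fun ψ hψ => ?_) hφ⟩
    exact hL.monotone _ _ _ (Set.subset_biUnion_of_mem (u := S) hψ) (hS ψ (hΔ hψ)).2.2
  structural := by
    rintro σ Γ φ ⟨Δ, hfin, hΔ, hφ⟩
    exact ⟨_, hfin.image _, Set.image_mono hΔ, hL.structural σ _ _ hφ⟩

theorem orderPreserving_finitary {K : Set ISStr.{u}} {Γ : Set Fm} {φ : Fm}
    (hφ : orderPreserving K Γ φ) : finitary (orderPreserving K) Γ φ := by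
  obtain ⟨rfl, hφ⟩ | ⟨-, γ, l, hγ, hl, hφ⟩ := hφ
  · exact ⟨∅, Set.finite_empty, subset_rfl, .inl ⟨rfl, hφ⟩⟩
  · refine ⟨{δ | δ ∈ γ :: l}, List.finite_toSet _, ?_, .inr ⟨?_, γ, l, ?_, ?_, hφ⟩⟩
    · rintro δ hδ
      obtain rfl | hδ := List.mem_cons.1 hδ
      exacts [hγ, hl δ hδ]
    · exact Set.Nonempty.ne_empty ⟨γ, by simp⟩
    · simp
    · intro δ hδ
      simp [hδ]

/-- All rules involved are finitary, so the calculus is contained in the finitary companion of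
each of its models. -/
theorem addRules_le_finitary_Log_IS3 (Γ : Set Fm) (φ : Fm)
    (hφ : addRules ISle.{u} {ruleKleene, ruleA, ruleB} Γ φ) :
    finitary (Log {⟨IS3, {IS3.top}⟩, ⟨IS3, IS3.up T1.zeroIn⟩}) Γ φ := by
  refine addRules_le (isLogic_Log _).finitary (fun Γ φ h => ?_) ?_ Γ φ hφ
  · obtain ⟨Δ, hfin, hΔ, hφ⟩ := orderPreserving_finitary h
    exact ⟨Δ, hfin, hΔ, ISle_le_Log (by simp) hφ⟩
  · rintro _ (rfl | rfl | rfl)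
    · refine ⟨_, Set.finite_singleton _, subset_rfl, ?_⟩
      rintro _ (rfl | rfl) h hΓ
      all_goals
        have h1 := hΓ _ rfl
        revert h1
        simp only [Fm.eval, p, q, r, mem_IS3_top, mem_IS3_up, ruleKleene]
        rcases h 0 with _ | ⟨⟩ | _ <;> rcases h 1 with _ | ⟨⟩ | _ <;>
          rcases h 2 with _ | ⟨⟩ | _ <;> simp [IS3, DMStr.withNabla]
    · refine ⟨_, Set.toFinite {p.neg.join r, p.nabla.join r}, subset_rfl, ?_⟩
      rintro _ (rfl | rfl) h hΓ
      all_goals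
        have h1 := hΓ _ (.inl rfl)
        have h2 := hΓ _ (.inr rfl)
        revert h1 h2
        simp only [Fm.eval, p, r, mem_IS3_top, mem_IS3_up, ruleA]
        rcases h 0 with _ | ⟨⟩ | _ <;> rcases h 2 with _ | ⟨⟩ | _ <;>
          simp [IS3, DMStr.withNabla]
    · refine ⟨_, Set.finite_singleton _, subset_rfl, ?_⟩
      rintro _ (rfl | rfl) h hΓ
      all_goals
        have h1 := hΓ _ rfl
        revert h1
        simp only [Fm.eval, p, r, mem_IS3_top, mem_IS3_up, ruleB]
        rcases h 0 with _ | ⟨⟩ | _ <;> rcases h 2 with _ | ⟨⟩ | _ <;>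
          simp [IS3, DMStr.withNabla]

/-- The filters `{⊤}` and `↑0` determine the order of the chain `IS₃`. -/
theorem IS3_meet_eq_left {x y : IS3.carrier} (h₁ : x = IS3.top → y = IS3.top)
    (h₂ : x ∈ IS3.up T1.zeroIn → y ∈ IS3.up T1.zeroIn) : IS3.meet x y = x := by
  rw [mem_IS3_up, mem_IS3_up] at h₂
  change x = Adj.ttop → y = Adj.ttop at h₁
  revert h₁ h₂
  rcases x with _ | ⟨⟩ | _ <;> rcases y with _ | ⟨⟩ | _ <;>
    simp [IS3, DMStr.withNabla]
  rfl

theorem foldl_meet_mem_imp {D : Set IS3.carrier}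
    (hD : ∀ x y, IS3.meet x y ∈ D → x ∈ D ∧ y ∈ D) (h : ℕ → IS3.carrier) (l : List Fm) :
    ∀ γ : Fm, (l.foldl Fm.meet γ).eval IS3 h ∈ D → γ.eval IS3 h ∈ D ∧ ∀ δ ∈ l, δ.eval IS3 h ∈ D := by
  induction l with
  | nil => exact fun γ hγ => ⟨hγ, by simp⟩
  | cons δ l ih =>
    intro γ hγ
    obtain ⟨h1, h2⟩ := ih _ hγ
    obtain ⟨h3, h4⟩ := hD _ _ h1
    refine ⟨h3, fun ε hε => ?_⟩
    obtain rfl | hε := List.mem_cons.1 hε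
    exacts [h4, h2 ε hε]

theorem finitary_Log_IS3_le_orderPreserving (Γ : Set Fm) (φ : Fm)
    (hφ : finitary (Log {⟨IS3, {IS3.top}⟩, ⟨IS3, IS3.up T1.zeroIn⟩}) Γ φ) :
    orderPreserving (varietyOf (isoCopies.{u} IS3)) Γ φ := by
  obtain ⟨Δ, hfin, hΔ, hφ⟩ := hφ
  obtain rfl | ⟨γ, hγ⟩ := Γ.eq_empty_or_nonempty
  · refine .inl ⟨rfl, (validIdentity_isoCopies fun h => ?_).varietyOf⟩
    exact hφ ⟨IS3, {IS3.top}⟩ (by simp) h fun δ hδ => (hΔ hδ).elim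
  · have hmem : ∀ δ, δ ∈ hfin.toFinset.toList ↔ δ ∈ Δ := by simp
    refine .inr ⟨Set.Nonempty.ne_empty ⟨γ, hγ⟩, γ, hfin.toFinset.toList, hγ,
      fun δ hδ => hΔ ((hmem δ).1 hδ), (validIdentity_isoCopies fun h => ?_).varietyOf⟩
    refine IS3_meet_eq_left (fun hx => ?_) (fun hx => ?_)
    · refine hφ ⟨IS3, {IS3.top}⟩ (by simp) h fun δ hδ =>
        (foldl_meet_mem_imp ?_ h _ γ hx).2 δ ((hmem δ).2 hδ)
      intro x y
      simp only [mem_IS3_top]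
      rcases x with _ | ⟨⟩ | _ <;> rcases y with _ | ⟨⟩ | _ <;> simp [IS3, DMStr.withNabla]
    · refine hφ ⟨IS3, IS3.up T1.zeroIn⟩ (by simp) h fun δ hδ =>
        (foldl_meet_mem_imp ?_ h _ γ hx).2 δ ((hmem δ).2 hδ)
      intro x y
      simp only [mem_IS3_up]
      rcases x with _ | ⟨⟩ | _ <;> rcases y with _ | ⟨⟩ | _ <;> simp [IS3, DMStr.withNabla]

theorem orderPreserving_variety_le_Log_IS3 (Γ : Set Fm) (φ : Fm)
    (hφ : orderPreserving (varietyOf (isoCopies.{u} IS3)) Γ φ) :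
    Log {⟨IS3, {IS3.top}⟩, ⟨IS3, IS3.up T1.zeroIn⟩} Γ φ := by
  refine orderPreserving_le_Log ?_ ?_ hφ
  · rintro _ (rfl | rfl) s t hst <;> exact eval_IS3_of_validIdentity_variety hst
  · rintro _ (rfl | rfl)
    exacts [isMatrixFilter_IS3_top, isMatrixFilter_IS3_up]

theorem consequence_antisymm {L L' : Consequence} (h : ∀ Γ φ, L Γ φ → L' Γ φ)
    (h' : ∀ Γ φ, L' Γ φ → L Γ φ) : L = L' :=
  funext fun Γ => funext fun φ => propext ⟨h Γ φ, h' Γ φ⟩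

end ISLogics

theorem mainTheorem11 :
    (ISLogics.Log {⟨ISLogics.IS6, {ISLogics.IS6.top}⟩}
        = ISLogics.Log {⟨ISLogics.IS5, {ISLogics.IS5.top}⟩} ∧
      ISLogics.Log {⟨ISLogics.IS5, {ISLogics.IS5.top}⟩}
        = ISLogics.Log {⟨ISLogics.IS4, {ISLogics.IS4.top}⟩} ∧
      ISLogics.Log {⟨ISLogics.IS4, {ISLogics.IS4.top}⟩}
        = ISLogics.Log {⟨ISLogics.IS3, {ISLogics.IS3.top}⟩} ∧
      ISLogics.Log {⟨ISLogics.IS3, {ISLogics.IS3.top}⟩}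
        = ISLogics.oneAssertional ISLogics.ISClass.{u} ∧
      ISLogics.oneAssertional ISLogics.ISClass.{u}
        = ISLogics.addRules ISLogics.ISle.{u} {ISLogics.ruleOne}) ∧
    (ISLogics.Log {⟨ISLogics.IS3, {ISLogics.IS3.top}⟩,
          ⟨ISLogics.IS3, ISLogics.IS3.up ISLogics.T1.zeroIn⟩}
        = ISLogics.orderPreserving (ISLogics.varietyOf (ISLogics.isoCopies.{u} ISLogics.IS3)) ∧
      ISLogics.orderPreserving (ISLogics.varietyOf (ISLogics.isoCopies.{u} ISLogics.IS3))
        = ISLogics.addRules ISLogics.ISle.{u}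
            {ISLogics.ruleKleene, ISLogics.ruleA, ISLogics.ruleB}) ∧
    (ISLogics.Log {⟨ISLogics.IS6, ISLogics.IS6.up ISLogics.DM4.zeroIn⟩}
        = ISLogics.Log {⟨ISLogics.IS5, ISLogics.IS5.up ISLogics.K3.zeroIn⟩} ∧
      ISLogics.Log {⟨ISLogics.IS5, ISLogics.IS5.up ISLogics.K3.zeroIn⟩}
        = ISLogics.Log {⟨ISLogics.IS4, ISLogics.IS4.up ISLogics.B2.zeroIn⟩} ∧
      ISLogics.Log {⟨ISLogics.IS4, ISLogics.IS4.up ISLogics.B2.zeroIn⟩}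
        = ISLogics.Log {⟨ISLogics.IS3, ISLogics.IS3.up ISLogics.T1.zeroIn⟩} ∧
      ISLogics.Log {⟨ISLogics.IS3, ISLogics.IS3.up ISLogics.T1.zeroIn⟩}
        = ISLogics.addRules ISLogics.ISle.{u} {ISLogics.axiomNabla}) := by
  open ISLogics in
  refine ⟨⟨?_, ?_, ?_, ?_, ?_⟩, ⟨?_, ?_⟩, ?_, ?_, ?_, ?_⟩
  · exact (Log_withNabla_top DM4).trans (Log_withNabla_top K3).symm
  · exact (Log_withNabla_top K3).trans (Log_withNabla_top B2).symm
  · exact Log_withNabla_top B2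
  · exact consequence_antisymm
      (fun Γ φ h => addRules_ruleOne_le_oneAssertional Γ φ (Log_IS3_top_le_addRules Γ φ h))
      oneAssertional_le_Log_IS3
  · exact consequence_antisymm
      (fun Γ φ h => Log_IS3_top_le_addRules Γ φ (oneAssertional_le_Log_IS3 Γ φ h))
      addRules_ruleOne_le_oneAssertional
  · exact consequence_antisymm
      (fun Γ φ h => finitary_Log_IS3_le_orderPreserving Γ φ
        (addRules_le_finitary_Log_IS3.{u} Γ φ (Log_IS3_pair_le_addRules Γ φ h)))
      orderPreserving_variety_le_Log_IS3
  · exact consequence_antisymm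
      (fun Γ φ h => Log_IS3_pair_le_addRules Γ φ (orderPreserving_variety_le_Log_IS3 Γ φ h))
      (fun Γ φ h => finitary_Log_IS3_le_orderPreserving Γ φ (addRules_le_finitary_Log_IS3 Γ φ h))
  · exact (Log_withNabla_up DM4 fun _ => rfl).trans (Log_withNabla_up K3 fun _ => rfl).symm
  · exact (Log_withNabla_up K3 fun _ => rfl).trans (Log_withNabla_up B2 fun _ => rfl).symm
  · exact Log_withNabla_up B2 fun _ => rfl
  · exact consequence_antisymm Log_IS3_up_le_addRules addRules_axiomNabla_le_Log_IS3
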